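/- Let $\alpha>0$ and $\rho>0$ be arbitrary. For $j\ge 1$ put $\lambda_j=(\pi j)^2-\alpha$ and $\phi_j(x)=\sin(\pi jx)$ (the eigenvalues and eigenfunctions of $-\partial_{xx}-\alpha$ on $(0,1)$ with Dirichlet boundary conditions), and let $N\ge 0$ be the number of indices $j$ with $\lambda_j<\rho$. Let $\rho<\gamma_1<\gamma_2<\dots<\gamma_N$ be real numbers, and put $$\Lambda_{\gamma_k}=\mathrm{diag}\Big(\frac1{\gamma_k-\lambda_i}\Big)_{1\le i\le N},\qquad B_0=\big(\phi_i'(1)\phi_j'(1)\big)_{1\le i,j\le N},\qquad B_k=\Lambda_{\gamma_k}B_0\Lambda_{\gamma_k}\quad(1\le k\le N).$$ Then $B_1+\dots+B_N$ is invertible. Put $B=(B_1+\dots+B_N)^{-1}$ and define, for $u\in L^2(0,1)$, $$F(u)=\sum_{k=1}^N F_k(u),\qquad F_k(u)=\Big\langle B\Big(\int_0^1u\,\phi_i\,dx\Big)_{1\le i\le N},\ \Big(\frac{\phi_i'(1)}{\gamma_k-\lambda_i}\Big)_{1\le i\le N}\Big\rangle_{\mathbb R^N}$$ (so $F=0$ if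 $N=0$). Consider the closed-loop linearized Fisher equation $$u_t-u_{xx}-\alpha u=0\ \text{ in }(0,1)\times(0,\infty),\qquad u(0,t)=0,\quad u(1,t)=U(t):=F(u(t)),\qquad u(\cdot,0)=u_0.$$ A solution with initial datum $u_0\in L^2(0,1)$ is a function $u\in C([0,\infty);L^2(0,1))$ with $u(0)=u_0$ such that, for all $\varphi\in C^2([0,1])$ with $\varphi(0)=\varphi(1)=0$ and all $t\ge 0$, $$\int_0^1u(t)\varphi\,dx=\int_0^1u_0\varphi\,dx+\int_0^t\Big(\int_0^1u(s)(\varphi''+\alpha\varphi)\,dx-U(s)\varphi'(1)\Big)ds .$$ For every $u_0\in L^2(0,1)$ there is exactly one solution. Moreover, there are constants $C>0$ and $\mu>0$, independent of $u_0$, such that for every $u_0\in L^2(0,1)$ the solution satisfies $$\|u(t)\|_{L^2(0,1)}\le Ce^{-\mu t}\|u_0\|_{L^2(0,1)}\qquad\text{for all }t\ge0 .$$ -/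

import Mathlib

open MeasureTheory Set

noncomputable section

namespace FisherBoundary

/-- The state space `L²(0,1)` of real functions, with its usual norm. -/
abbrev L2 : Type := Lp ℝ 2 (volume.restrict (Ioo (0 : ℝ) 1))

/-- The pairing `∫₀¹ u(x) φ(x) dx` of a state with a (continuous) function `φ`. -/
def pairing (u : L2) (φ : ℝ → ℝ) : ℝ := ∫ x in Ioo (0 : ℝ) 1, u x * φ x

/-- The eigenfunctions `φ_j(x) = sin(π j x)` of `-∂ₓₓ - α` with Dirichlet conditions, `j ≥ 1`. -/
def mode (j : ℕ) (x : ℝ) : ℝ := Real.sin (Real.pi * j * x)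

/-- The eigenvalues `λ_j = (π j)² - α`, `j ≥ 1`. -/
def eigenvalue (α : ℝ) (j : ℕ) : ℝ := (Real.pi * j) ^ 2 - α

/-- The vector `(φ_1'(1), …, φ_N'(1))`; the index `i : Fin N` stands for the mode `i + 1`. -/
def normalDeriv (N : ℕ) (i : Fin N) : ℝ := deriv (mode (i + 1)) 1

/-- The Gram matrix `B₀` with entries `φ_i'(1) φ_j'(1)`. -/
def gram (N : ℕ) : Matrix (Fin N) (Fin N) ℝ :=
  Matrix.of fun i j => normalDeriv N i * normalDeriv N j

/-- The matrix `Λ_g = diag (1 / (g - λ_i))`, `1 ≤ i ≤ N`. -/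
def Lam (α : ℝ) (N : ℕ) (g : ℝ) : Matrix (Fin N) (Fin N) ℝ :=
  Matrix.diagonal fun i => 1 / (g - eigenvalue α (i + 1))

/-- The sum `B_1 + ⋯ + B_N`, where `B_k = Λ_{γ_k} B₀ Λ_{γ_k}`. -/
def sumB (α : ℝ) (N : ℕ) (γ : Fin N → ℝ) : Matrix (Fin N) (Fin N) ℝ :=
  ∑ k, Lam α N (γ k) * gram N * Lam α N (γ k)

/-- The vector `(∫₀¹ u φ_1, …, ∫₀¹ u φ_N)`. -/
def moments (N : ℕ) (u : L2) (i : Fin N) : ℝ := pairing u (mode (i + 1))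

/-- The `k`-th feedback `F_k(u) = ⟨B (∫₀¹ u φ_i)_i, (φ_i'(1) / (γ_k - λ_i))_i⟩`, with
`B = (B_1 + ⋯ + B_N)⁻¹`. -/
def feedbackPart (α : ℝ) (N : ℕ) (γ : Fin N → ℝ) (k : Fin N) (u : L2) : ℝ :=
  dotProduct (Matrix.mulVec (sumB α N γ)⁻¹ (moments N u))
    (fun i => 1 / (γ k - eigenvalue α (i + 1)) * normalDeriv N i)

/-- The feedback `F(u) = ∑ₖ F_k(u)`. -/
def feedback (α : ℝ) (N : ℕ) (γ : Fin N → ℝ) (u : L2) : ℝ :=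
  ∑ k, feedbackPart α N γ k u

/-- Solutions, for initial datum `u₀ ∈ L²(0,1)`, of the boundary control problem
`u_t - u_xx - α u = 0` on `(0,1) × (0,∞)`, `u(0,t) = 0`, `u(1,t) = U(t)`, `u(·,0) = u₀`:
functions in `C([0,∞); L²(0,1))` that solve the problem in the sense of transposition.
The test functions are the `C²` functions `φ` on `[0,1]` with `φ(0) = φ(1) = 0`;
two integrations by parts of `∫₀¹ u_xx φ` with the boundary values of `u` produce
`∫₀¹ u φ'' - U φ'(1)`. Only the values of `u` and `U` at times `t ≥ 0` matter. -/
structure IsBoundarySolution (α : ℝ) (U : ℝ → ℝ) (u₀ : L2) (u : ℝ → L2) : Prop where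
  continuousOn : ContinuousOn u (Ici 0)
  initial : u 0 = u₀
  weak : ∀ φ : ℝ → ℝ, ContDiff ℝ 2 φ → φ 0 = 0 → φ 1 = 0 → ∀ t : ℝ, 0 ≤ t →
    pairing (u t) φ = pairing u₀ φ +
      ∫ s in (0 : ℝ)..t,
        (pairing (u s) (fun x => deriv (deriv φ) x + α * φ x) - U s * deriv φ 1)

/-- Solutions of the closed-loop problem, in which `U(t) = F(u(t))`. -/
def IsClosedLoopSolution (α : ℝ) (N : ℕ) (γ : Fin N → ℝ) (u₀ : L2) (u : ℝ → L2) : Prop :=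
  IsBoundarySolution α (fun t => feedback α N γ (u t)) u₀ u

end FisherBoundary

end

noncomputable section

namespace FisherBoundary

/-! Testing the equation with `sin(πjx)` turns it into scalar equations `m_j' = -λ_j m_j - φ_j'(1)
U` for the sine coefficients, coupled only through `U`, which depends only on the first `N` of them.
Let `P` be the matrix with columns `Λ_{γ_k} b`, where `b = (φ_i'(1))_i`. Then `B_1 + ⋯ + B_N = P
Pᵀ`, and `P` is a Cauchy matrix up to nonzero row factors, hence invertible (`isUnit_colMat`). It
follows that `F(u) = ∑ w_k` with `w = P⁻¹ m` (`feedback_eq`). Since `λ_i P_ik + b_i = γ_k P_ik`, the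
low modes decouple into `w_k' = -γ_k w_k` (`loopCoord_field`), so they and `U` decay exponentially.

The remaining modes have `λ_j ≥ ρ` and are driven by a decaying input. The gain `φ_j'(1)` grows like
`j` and `λ_j` like `j²`, so the response to `U` is `O(1/j)`, which is square-summable
(`exists_modalFlow_bound`). Parseval turns these coefficient bounds into decay in `L²` at rate `ρ/2`
(`exists_decay`). Because the problem is linear, decay of the solution with datum zero gives
uniqueness.

For existence the coefficient equations are solved explicitly, the coefficients are summed to a
continuous curve in `L²`, and the transposition identity is recovered term by term from the sine
series of the test function (`isBoundarySolution_of_coeff`). The boundary term comes from the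
expansion of `φ'(1)` in `hasSum_deriv_one`. -/

/-! ### Pairing with continuous functions as an inner product -/

lemma memLp_two_of_continuous {φ : ℝ → ℝ} (hφ : Continuous φ) :
    MemLp φ 2 (volume.restrict (Ioo (0 : ℝ) 1)) := by
  obtain ⟨C, hC⟩ := isCompact_Icc.exists_bound_of_continuousOn (s := Icc (0 : ℝ) 1) hφ.continuousOn
  refine MemLp.of_bound hφ.aestronglyMeasurable C ?_
  filter_upwards [ae_restrict_mem measurableSet_Ioo] with x hx using hC x (Ioo_subset_Icc_self hx)

/-- The class in `L²(0,1)` of a continuous function. -/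
def ofContinuous (φ : ℝ → ℝ) (hφ : Continuous φ) : L2 := (memLp_two_of_continuous hφ).toLp φ

lemma coeFn_ofContinuous {φ : ℝ → ℝ} (hφ : Continuous φ) :
    ofContinuous φ hφ =ᵐ[volume.restrict (Ioo (0 : ℝ) 1)] φ :=
  MemLp.coeFn_toLp _

lemma pairing_eq_inner {φ : ℝ → ℝ} (hφ : Continuous φ) (u : L2) :
    pairing u φ = inner ℝ (ofContinuous φ hφ) u := by
  rw [L2.inner_def, pairing]
  refine integral_congr_ae ?_
  filter_upwards [coeFn_ofContinuous hφ] with x hx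
  simp [hx]

lemma inner_ofContinuous {φ ψ : ℝ → ℝ} (hφ : Continuous φ) (hψ : Continuous ψ) :
    inner ℝ (ofContinuous φ hφ) (ofContinuous ψ hψ) = ∫ x in (0 : ℝ)..1, φ x * ψ x := by
  rw [L2.inner_def, intervalIntegral.integral_of_le zero_le_one, ← restrict_Ioo_eq_restrict_Ioc]
  refine integral_congr_ae ?_
  filter_upwards [coeFn_ofContinuous hφ, coeFn_ofContinuous hψ] with x hx hy
  simp [hx, hy, mul_comm]

lemma pairing_sub {φ : ℝ → ℝ} (hφ : Continuous φ) (u v : L2) :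
    pairing (u - v) φ = pairing u φ - pairing v φ := by
  simp only [pairing_eq_inner hφ, inner_sub_right]

lemma continuous_mode (j : ℕ) : Continuous (mode j) := by
  unfold mode; fun_prop

lemma pairing_zero_right (u : L2) : pairing u (fun _ => 0) = 0 := by simp [pairing]

lemma integrable_mul_continuous (u : L2) {φ : ℝ → ℝ} (hφ : Continuous φ) :
    IntegrableOn (fun x => u x * φ x) (Ioo (0 : ℝ) 1) :=
  MemLp.integrable_mul (Lp.memLp u) (memLp_two_of_continuous hφ)

lemma pairing_add_right (u : L2) {φ ψ : ℝ → ℝ} (hφ : Continuous φ) (hψ : Continuous ψ) :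
    pairing u (fun x => φ x + ψ x) = pairing u φ + pairing u ψ := by
  unfold pairing
  rw [← integral_add (integrable_mul_continuous u hφ) (integrable_mul_continuous u hψ)]
  simp only [mul_add]

lemma pairing_const_mul (u : L2) (c : ℝ) (φ : ℝ → ℝ) :
    pairing u (fun x => c * φ x) = c * pairing u φ := by
  unfold pairing
  rw [← integral_const_mul]
  congr 1; ext x; ring

/-! ### Completeness of the sines in `L²(0,1)` -/

/-- Induction on `n` through `2 sin((j+1)θ) cos θ = sin((j+2)θ) + sin(jθ)`. The trivial index `j =
0` is included because the recursion reaches it. -/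
lemma pairing_mode_mul_cos_pow (u : L2) (h : ∀ j : ℕ, pairing u (mode (j + 1)) = 0) (n : ℕ) :
    ∀ j : ℕ, pairing u (fun x => mode j x * Real.cos (Real.pi * x) ^ n) = 0 := by
  have h0 : ∀ j, pairing u (mode j) = 0 := by
    intro j
    cases j with
    | zero =>
      have : mode 0 = fun _ => 0 := by ext x; simp [mode]
      rw [this, pairing_zero_right]
    | succ j => exact h j
  induction n with
  | zero => intro j; simpa using h0 j
  | succ n ih =>
    intro j
    cases j with
    | zero =>
      have : (fun x => mode 0 x * Real.cos (Real.pi * x) ^ (n + 1)) = fun _ => 0 := by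
        ext x; simp [mode]
      rw [this, pairing_zero_right]
    | succ j =>
      have e : (fun x => mode (j + 1) x * Real.cos (Real.pi * x) ^ (n + 1)) = fun x =>
          (1 / 2) * (mode (j + 2) x * Real.cos (Real.pi * x) ^ n) +
          (1 / 2) * (mode j x * Real.cos (Real.pi * x) ^ n) := by
        ext x
        have a1 : mode (j + 2) x = Real.sin (Real.pi * (j + 1) * x + Real.pi * x) := by
          simp only [mode]; push_cast; ring_nf
        have a2 : mode j x = Real.sin (Real.pi * (j + 1) * x - Real.pi * x) := by
          simp only [mode]; ring_nf
        have a3 : mode (j + 1) x = Real.sin (Real.pi * (j + 1) * x) := by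
          simp only [mode]; push_cast; ring_nf
        rw [a1, a2, a3, Real.sin_add, Real.sin_sub]
        ring
      have hc : ∀ i, Continuous (fun x => mode i x * Real.cos (Real.pi * x) ^ n) := fun i =>
        (continuous_mode i).mul (by fun_prop)
      have hs := pairing_add_right u
        (φ := fun x => (1 / 2) * (mode (j + 2) x * Real.cos (Real.pi * x) ^ n))
        (ψ := fun x => (1 / 2) * (mode j x * Real.cos (Real.pi * x) ^ n))
        (continuous_const.mul (hc _)) (continuous_const.mul (hc _))
      rw [e, hs, pairing_const_mul, pairing_const_mul, ih, ih]
      ring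

lemma pairing_mode_mul_polynomial (u : L2) (h : ∀ j : ℕ, pairing u (mode (j + 1)) = 0)
    (p : Polynomial ℝ) :
    pairing u (fun x => mode 1 x * p.eval (Real.cos (Real.pi * x))) = 0 := by
  have hm := continuous_mode 1
  induction p using Polynomial.induction_on' with
  | add p q hp hq =>
    simp only [Polynomial.eval_add, mul_add]
    have hs := pairing_add_right u (φ := fun x => mode 1 x * p.eval (Real.cos (Real.pi * x)))
      (ψ := fun x => mode 1 x * q.eval (Real.cos (Real.pi * x)))
      (hm.mul (by fun_prop)) (hm.mul (by fun_prop))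
    rw [hs, hp, hq, add_zero]
  | monomial n a =>
    simp only [Polynomial.eval_monomial]
    have := pairing_mode_mul_cos_pow u h n 1
    rw [← mul_zero a, ← this, ← pairing_const_mul]
    congr 1; ext x; ring

/-- Since `cos(πx)` is a coordinate on `[0,1]`, Weierstrass approximation makes polynomials in it
uniformly dense in the continuous functions. -/
lemma pairing_mode_mul_continuous (u : L2) (h : ∀ j : ℕ, pairing u (mode (j + 1)) = 0)
    {g : ℝ → ℝ} (hg : Continuous g) : pairing u (fun x => mode 1 x * g x) = 0 := by
  set I := ∫ x in Ioo (0 : ℝ) 1, |u x * mode 1 x| with hI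
  have hint := integrable_mul_continuous u (continuous_mode 1)
  have hI0 : 0 ≤ I := integral_nonneg fun _ => abs_nonneg _
  have key : ∀ ε > 0, |pairing u (fun x => mode 1 x * g x)| ≤ ε * I := by
    intro ε hε
    -- Approximating `g(arccos y / π)` on `[-1,1]` makes `p(cos πx)` approximate `g(x)` on `(0,1)`.
    obtain ⟨p, hp⟩ := exists_polynomial_near_of_continuousOn (-1) 1
      (fun y => g (Real.arccos y / Real.pi)) (by
        have := Real.continuous_arccos
        exact (hg.comp (this.div_const _)).continuousOn) ε hε
    have hpc : Continuous fun x => mode 1 x * p.eval (Real.cos (Real.pi * x)) :=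
      (continuous_mode 1).mul (by fun_prop)
    have e : pairing u (fun x => mode 1 x * g x) =
        ∫ x in Ioo (0 : ℝ) 1, (u x * mode 1 x) * (g x - p.eval (Real.cos (Real.pi * x))) := by
      refine (sub_zero (pairing u fun x => mode 1 x * g x)).symm.trans ?_
      refine (congrArg _ (pairing_mode_mul_polynomial u h p).symm).trans ?_
      unfold pairing
      refine (integral_sub (integrable_mul_continuous u ((continuous_mode 1).mul hg))
        (integrable_mul_continuous u hpc)).symm.trans ?_
      simp only [Pi.mul_apply]
      congr 1; ext x; ring
    rw [e, hI, ← integral_const_mul, ← Real.norm_eq_abs]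
    refine norm_integral_le_of_norm_le (hint.abs.const_mul ε) ?_
    filter_upwards [ae_restrict_mem measurableSet_Ioo] with x hx
    rw [norm_mul, Real.norm_eq_abs, Real.norm_eq_abs, mul_comm]
    refine mul_le_mul_of_nonneg_right ?_ (abs_nonneg _)
    have := hp (Real.cos (Real.pi * x)) ⟨Real.neg_one_le_cos _, Real.cos_le_one _⟩
    rw [Real.arccos_cos (mul_nonneg Real.pi_pos.le hx.1.le)
      (by nlinarith [Real.pi_pos, hx.2]), mul_div_cancel_left₀ _ Real.pi_ne_zero, abs_sub_comm] at this
    exact this.le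
  by_contra hne
  have hpos : 0 < |pairing u (fun x => mode 1 x * g x)| := abs_pos.mpr hne
  -- With this `ε` the bound is less than half of the left side; `I + 1` avoids dividing by `I = 0`.
  have := key (|pairing u (fun x => mode 1 x * g x)| / (2 * (I + 1))) (by positivity)
  rw [div_mul_eq_mul_div, le_div_iff₀ (by positivity)] at this
  nlinarith

lemma mode_one_pos {x : ℝ} (hx : x ∈ Ioo (0 : ℝ) 1) : 0 < mode 1 x := by
  unfold mode
  apply Real.sin_pos_of_pos_of_lt_pi
  · have := Real.pi_pos; have := hx.1; simp; positivity
  · have := Real.pi_pos; have := hx.2; simp; nlinarith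

/-- The functions `sin(π j x)`, `j ≥ 1`, are complete in `L²(0,1)`. -/
lemma eq_zero_of_pairing_mode_eq_zero (u : L2) (h : ∀ j : ℕ, pairing u (mode (j + 1)) = 0) :
    u = 0 := by
  have hint := integrable_mul_continuous u (continuous_mode 1)
  -- The function `u(x) sin(πx)` integrates to zero against every smooth compactly supported
  -- function, so it vanishes almost everywhere; `sin(πx) > 0` on `(0,1)` then removes the factor.
  have h1 := isOpen_Ioo.ae_eq_zero_of_integral_contDiff_smul_eq_zero (μ := volume)
    (hint.locallyIntegrableOn) (fun g hg _ hs => by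
      have hz := pairing_mode_mul_continuous u h hg.continuous
      rw [← setIntegral_eq_integral_of_forall_compl_eq_zero (s := Ioo (0 : ℝ) 1)]
      · refine Eq.trans ?_ hz
        unfold pairing; congr 1; ext x; simp only [smul_eq_mul]; ring
      · intro x hx
        have : g x = 0 := by
          by_contra hgx
          exact hx (hs (subset_tsupport _ hgx))
        simp [this])
  rw [Lp.eq_zero_iff_ae_eq_zero]
  rw [← ae_restrict_iff' measurableSet_Ioo] at h1
  filter_upwards [h1, ae_restrict_mem measurableSet_Ioo] with x hx hxm
  simpa [(mode_one_pos hxm).ne'] using hx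

/-! ### The sine basis and Parseval expansions -/

lemma integral_cos_int_mul {n : ℤ} (hn : n ≠ 0) :
    ∫ x in (0 : ℝ)..1, Real.cos (Real.pi * n * x) = 0 := by
  have hn' : Real.pi * n ≠ 0 := mul_ne_zero Real.pi_ne_zero (by exact_mod_cast hn)
  rw [intervalIntegral.integral_comp_mul_left (fun y => Real.cos y) hn', integral_cos]
  simp [mul_comm Real.pi, Real.sin_int_mul_pi]

lemma integral_mode_mul_mode (i j : ℕ) :
    ∫ x in (0 : ℝ)..1, (√2 * mode (i + 1) x) * (√2 * mode (j + 1) x) = if i = j then 1 else 0 := by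
  have e : ∀ x, (√2 * mode (i + 1) x) * (√2 * mode (j + 1) x) =
      Real.cos (Real.pi * ((i - j : ℤ) : ℝ) * x) - Real.cos (Real.pi * ((i + j + 2 : ℤ) : ℝ) * x) := by
    intro x
    have a : Real.pi * ((i - j : ℤ) : ℝ) * x =
      Real.pi * (i + 1 : ℕ) * x - Real.pi * (j + 1 : ℕ) * x := by push_cast; ring
    have b : Real.pi * ((i + j + 2 : ℤ) : ℝ) * x =
      Real.pi * (i + 1 : ℕ) * x + Real.pi * (j + 1 : ℕ) * x := by push_cast; ring
    rw [a, b, Real.cos_sub, Real.cos_add]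
    simp only [mode]
    have := Real.mul_self_sqrt (zero_le_two (α := ℝ))
    linear_combination (Real.sin (Real.pi * (i + 1 : ℕ) * x) * Real.sin (Real.pi * (j + 1 : ℕ) * x)) * this
  simp only [e]
  rw [intervalIntegral.integral_sub (Continuous.intervalIntegrable (by fun_prop) _ _)
    (Continuous.intervalIntegrable (by fun_prop) _ _), integral_cos_int_mul (n := i + j + 2) (by omega)]
  split_ifs with hij
  · subst hij; simp
  · rw [integral_cos_int_mul (by omega), sub_zero]

/-- The normalised eigenfunctions `√2 sin(π (j + 1) x)` as elements of `L²(0,1)`. -/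
def sineVec (j : ℕ) : L2 :=
  ofContinuous (fun x => √2 * mode (j + 1) x) (continuous_const.mul (continuous_mode _))

lemma inner_sineVec (j : ℕ) (u : L2) : inner ℝ (sineVec j) u = √2 * pairing u (mode (j + 1)) := by
  rw [sineVec, ← pairing_eq_inner, pairing_const_mul]

lemma orthonormal_sineVec : Orthonormal ℝ sineVec := by
  classical
  rw [orthonormal_iff_ite]
  intro i j
  rw [sineVec, sineVec, inner_ofContinuous, integral_mode_mul_mode]

/-- The Hilbert basis of normalised eigenfunctions. -/
def sineBasis : HilbertBasis ℕ ℝ L2 :=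
  HilbertBasis.mkOfOrthogonalEqBot orthonormal_sineVec (by
    rw [Submodule.eq_bot_iff]
    intro u hu
    refine eq_zero_of_pairing_mode_eq_zero u fun j => ?_
    have := (Submodule.mem_orthogonal _ _).1 hu (sineVec j) (Submodule.subset_span ⟨j, rfl⟩)
    rw [inner_sineVec] at this
    simpa using this)

lemma sineBasis_apply (j : ℕ) : sineBasis j = sineVec j := by
  simp [sineBasis]

/-- The sine coefficients `∫₀¹ φ(x) sin(π (j + 1) x) dx` of a function. -/
def sineCoeff (φ : ℝ → ℝ) (j : ℕ) : ℝ := ∫ x in (0 : ℝ)..1, φ x * mode (j + 1) x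

lemma pairing_ofContinuous {φ : ℝ → ℝ} (hφ : Continuous φ) (j : ℕ) :
    pairing (ofContinuous φ hφ) (mode (j + 1)) = sineCoeff φ j := by
  rw [pairing_eq_inner (continuous_mode _), inner_ofContinuous, sineCoeff]
  simp only [mul_comm]

/-- Parseval for the basis `√2 sin(π(j+1)x)`. The pairings use unnormalised sines, whence the factor
`2` here and in all later series. -/
lemma hasSum_inner_eq_pairing (u v : L2) :
    HasSum (fun j => 2 * pairing u (mode (j + 1)) * pairing v (mode (j + 1))) (inner ℝ u v) := by
  have h := sineBasis.hasSum_inner_mul_inner u v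
  convert! h using 2 with j
  rw [sineBasis_apply, real_inner_comm, inner_sineVec, inner_sineVec]
  linear_combination -(pairing u (mode (j + 1)) * pairing v (mode (j + 1))) *
    Real.mul_self_sqrt (zero_le_two (α := ℝ))

lemma hasSum_sq_pairing (u : L2) :
    HasSum (fun j => 2 * pairing u (mode (j + 1)) ^ 2) (‖u‖ ^ 2) := by
  rw [← real_inner_self_eq_norm_sq]
  convert hasSum_inner_eq_pairing u u using 2
  ring

lemma hasSum_pairing {φ : ℝ → ℝ} (hφ : Continuous φ) (u : L2) :
    HasSum (fun j => 2 * sineCoeff φ j * pairing u (mode (j + 1))) (pairing u φ) := by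
  rw [pairing_eq_inner hφ]
  simpa only [pairing_ofContinuous] using hasSum_inner_eq_pairing (ofContinuous φ hφ) u

lemma hasSum_sineCoeff_mul {φ ψ : ℝ → ℝ} (hφ : Continuous φ) (hψ : Continuous ψ) :
    HasSum (fun j => 2 * sineCoeff φ j * sineCoeff ψ j) (∫ x in (0 : ℝ)..1, φ x * ψ x) := by
  rw [← inner_ofContinuous hφ hψ]
  simpa only [pairing_ofContinuous] using
    hasSum_inner_eq_pairing (ofContinuous φ hφ) (ofContinuous ψ hψ)

lemma summable_sq_sineCoeff {φ : ℝ → ℝ} (hφ : Continuous φ) :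
    Summable fun j => sineCoeff φ j ^ 2 := by
  have := (hasSum_sq_pairing (ofContinuous φ hφ)).summable
  rw [summable_mul_left_iff two_ne_zero] at this
  simpa only [pairing_ofContinuous] using this

lemma abs_pairing_mode_le (u : L2) (j : ℕ) : |pairing u (mode (j + 1))| ≤ ‖u‖ := by
  have h := le_hasSum (hasSum_sq_pairing u) j fun i _ => by positivity
  refine abs_le_of_sq_le_sq ?_ (norm_nonneg u)
  nlinarith [sq_nonneg (pairing u (mode (j + 1)))]

/-- A family of continuous, uniformly square-summable coefficients defines a continuous curve
in `L²(0,1)`. -/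
lemma exists_continuousOn_of_coeff {s : Set ℝ} (f : ℕ → ℝ → ℝ) (hf : ∀ j, Continuous (f j))
    (c : ℕ → ℝ) (hc : Summable fun j => c j ^ 2) (hfc : ∀ j, ∀ t ∈ s, |f j t| ≤ c j) :
    ∃ u : ℝ → L2, ContinuousOn u s ∧ ∀ t ∈ s, ∀ j, pairing (u t) (mode (j + 1)) = f j t := by
  classical
  have hmem : ∀ t ∈ s, Memℓp (fun j => √2 * f j t) 2 := by
    intro t ht
    refine memℓp_gen ?_
    simp only [ENNReal.toReal_ofNat, Real.rpow_two, Real.norm_eq_abs, sq_abs, mul_pow]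
    refine Summable.mul_left _ (hc.of_nonneg_of_le (fun _ => sq_nonneg _) fun j => ?_)
    exact sq_le_sq' (by linarith [neg_abs_le (f j t), hfc j t ht]) ((le_abs_self _).trans (hfc j t ht))
  let u : ℝ → L2 := fun t => if ht : t ∈ s then sineBasis.repr.symm ⟨_, hmem t ht⟩ else 0
  have hu : ∀ t ∈ s, ∀ j, pairing (u t) (mode (j + 1)) = f j t := by
    intro t ht j
    have h1 : sineBasis.repr (u t) j = √2 * f j t := by
      simp only [u, dif_pos ht, LinearIsometryEquiv.apply_symm_apply]
    rw [HilbertBasis.repr_apply_apply, sineBasis_apply, inner_sineVec] at h1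
    exact mul_left_cancel₀ (by positivity) h1
  refine ⟨u, fun t ht => ?_, hu⟩
  rw [ContinuousWithinAt, tendsto_iff_norm_sub_tendsto_zero]
  have hsq : Filter.Tendsto (fun r => ‖u r - u t‖ ^ 2) (nhdsWithin t s) (nhds 0) := by
    have e : ∀ r, ‖u r - u t‖ ^ 2 = ∑' j, 2 * pairing (u r - u t) (mode (j + 1)) ^ 2 := fun r =>
      (hasSum_sq_pairing _).tsum_eq.symm
    simp only [e]
    suffices h0 : Filter.Tendsto (fun r => ∑' j, 2 * pairing (u r - u t) (mode (j + 1)) ^ 2)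
      (nhdsWithin t s) (nhds (∑' _ : ℕ, (0 : ℝ))) by simpa only [tsum_zero] using h0
    -- Both values are bounded by `c j`, so the difference is at most `2 c j`, and `2 (2 c j)² = 8
    -- (c j)²`.
    refine tendsto_tsum_of_dominated_convergence (bound := fun j => 8 * c j ^ 2) (hc.mul_left _) ?_ ?_
    · intro j
      have hc1 : Filter.Tendsto (fun r => 2 * (f j r - f j t) ^ 2) (nhdsWithin t s) (nhds 0) := by
        have : Continuous fun r => 2 * (f j r - f j t) ^ 2 := by have := hf j; fun_prop
        have h2 := this.continuousWithinAt (s := s) (x := t)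
        simpa [ContinuousWithinAt] using h2
      refine hc1.congr' ?_
      filter_upwards [self_mem_nhdsWithin] with r hr
      rw [pairing_sub (continuous_mode _), hu r hr, hu t ht]
    · filter_upwards [self_mem_nhdsWithin] with r hr j
      rw [pairing_sub (continuous_mode _), hu r hr, hu t ht, Real.norm_of_nonneg (by positivity)]
      have h1 := abs_le.1 (hfc j r hr)
      have h2 := abs_le.1 (hfc j t ht)
      nlinarith [sq_le_sq' (a := f j r - f j t) (b := 2 * c j) (by linarith) (by linarith)]
  have := hsq.sqrt
  simpa using this

/-! ### Boundary derivatives and distinct eigenvalues -/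

lemma hasDerivAt_mode (j : ℕ) (x : ℝ) :
    HasDerivAt (mode j) (Real.pi * j * Real.cos (Real.pi * j * x)) x := by
  unfold mode
  have h := (Real.hasDerivAt_sin (Real.pi * j * x)).comp x ((hasDerivAt_id x).const_mul (Real.pi * j))
  simpa [Function.comp_def, mul_comm] using h

lemma deriv_mode_one (j : ℕ) : deriv (mode j) 1 = Real.pi * j * (-1) ^ j := by
  rw [(hasDerivAt_mode j 1).deriv, mul_one, mul_comm Real.pi, Real.cos_nat_mul_pi]

lemma abs_deriv_mode_one (j : ℕ) : |deriv (mode j) 1| = Real.pi * j := by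
  rw [deriv_mode_one, abs_mul, abs_pow]
  simp [Real.pi_pos.le]

lemma normalDeriv_ne_zero {N : ℕ} (i : Fin N) : normalDeriv N i ≠ 0 := by
  rw [normalDeriv, ← abs_pos, abs_deriv_mode_one]
  have := Real.pi_pos
  positivity

lemma eigenvalue_injective (α : ℝ) : Function.Injective (eigenvalue α) := by
  intro i j h
  have h1 : (Real.pi * i) ^ 2 = (Real.pi * j) ^ 2 := by simpa [eigenvalue] using h
  have h2 := (pow_left_inj₀ (by have := Real.pi_pos; positivity)
    (by have := Real.pi_pos; positivity) two_ne_zero).1 h1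
  exact_mod_cast mul_left_cancel₀ Real.pi_ne_zero h2

/-! ### The Cauchy matrix and the diagonalised feedback -/

/-- Vectors annihilated by a Cauchy matrix `(1 / (x k - y i))` vanish. -/
lemma eq_zero_of_cauchy_sum_eq_zero {ι : Type*} [Fintype ι] {K : Type*} [Field K]
    {x y : ι → K} (hx : Function.Injective x) (hy : Function.Injective y)
    (hxy : ∀ k i, x k ≠ y i) {a : ι → K} (h : ∀ k, ∑ i, a i / (x k - y i) = 0) : a = 0 := by
  classical
  -- `Q` is the numerator of `∑ a i / (X - y i)` over the common denominator. It has degree below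
  -- the number of its roots `x k`, so it is zero; evaluating it at `y i` isolates `a i`.
  let Q : Polynomial K := ∑ i, Polynomial.C (a i) *
    ∏ l ∈ Finset.univ.erase i, (Polynomial.X - Polynomial.C (y l))
  have hQ : Q = 0 := by
    refine Polynomial.eq_zero_of_degree_lt_of_eval_index_eq_zero Finset.univ (v := x)
      hx.injOn ?_ ?_
    · refine lt_of_le_of_lt (Polynomial.degree_sum_le _ _) ?_
      rw [Finset.sup_lt_iff (WithBot.bot_lt_coe _)]
      intro i _
      rw [← Polynomial.smul_eq_C_mul]
      refine lt_of_le_of_lt (Polynomial.degree_smul_le _ _) ?_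
      rw [Polynomial.degree_prod]
      simp only [Polynomial.degree_X_sub_C, Finset.sum_const, Finset.card_erase_of_mem
        (Finset.mem_univ i)]
      have : 0 < (Finset.univ : Finset ι).card := Finset.card_pos.2 ⟨i, Finset.mem_univ i⟩
      rw [nsmul_eq_mul, mul_one]
      exact_mod_cast Nat.sub_lt this one_pos
    · intro k _
      have e : Polynomial.eval (x k) Q = (∏ l, (x k - y l)) * ∑ i, a i / (x k - y i) := by
        simp only [Q, Polynomial.eval_finsetSum, Polynomial.eval_mul, Polynomial.eval_C,
          Polynomial.eval_prod, Polynomial.eval_sub, Polynomial.eval_X, Finset.mul_sum]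
        refine Finset.sum_congr rfl fun i _ => ?_
        rw [← Finset.mul_prod_erase Finset.univ (fun l => x k - y l) (Finset.mem_univ i)]
        field_simp [sub_ne_zero.2 (hxy k i)]
      rw [e, h, mul_zero]
  ext i
  have e : Polynomial.eval (y i) Q = a i * ∏ l ∈ Finset.univ.erase i, (y i - y l) := by
    simp only [Q, Polynomial.eval_finsetSum, Polynomial.eval_mul, Polynomial.eval_C,
      Polynomial.eval_prod, Polynomial.eval_sub, Polynomial.eval_X]
    refine Finset.sum_eq_single i (fun j _ hj => ?_) (by simp)
    rw [Finset.prod_eq_zero (i := i) (by simp [hj.symm]) (sub_self _), mul_zero]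
  rw [hQ, Polynomial.eval_zero] at e
  have hne : ∏ l ∈ Finset.univ.erase i, (y i - y l) ≠ 0 := by
    rw [Finset.prod_ne_zero_iff]
    intro l hl
    exact sub_ne_zero.2 fun hil => (Finset.ne_of_mem_erase hl) (hy hil).symm
  simpa [hne] using e.symm

/-- The matrix whose `k`-th column is `Λ_{γ_k} (φ_i'(1))_i`. -/
def colMat (α : ℝ) (N : ℕ) (γ : Fin N → ℝ) : Matrix (Fin N) (Fin N) ℝ :=
  Matrix.of fun i k => 1 / (γ k - eigenvalue α (i + 1)) * normalDeriv N i

lemma sumB_eq (α : ℝ) (N : ℕ) (γ : Fin N → ℝ) :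
    sumB α N γ = colMat α N γ * (colMat α N γ).transpose := by
  ext i j
  rw [sumB, Matrix.sum_apply, Matrix.mul_apply]
  refine Finset.sum_congr rfl fun k _ => ?_
  rw [Lam, Matrix.mul_diagonal, Matrix.diagonal_mul]
  simp only [gram, colMat, Matrix.of_apply, Matrix.transpose_apply]
  ring

/-- The transpose is the Cauchy matrix `1 / (γ_k - λ_i)` with columns scaled by the nonzero numbers
`φ_i'(1)`, so its kernel is trivial. -/
lemma isUnit_colMat {α : ℝ} {N : ℕ} {γ : Fin N → ℝ} (hγ : Function.Injective γ)
    (hne : ∀ (k i : Fin N), γ k ≠ eigenvalue α (i + 1)) : IsUnit (colMat α N γ) := by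
  rw [← Matrix.isUnit_transpose, ← Matrix.mulVec_injective_iff_isUnit]
  rw [← Matrix.coe_mulVecLin, ← LinearMap.ker_eq_bot, LinearMap.ker_eq_bot']
  intro x hx
  have h0 := eq_zero_of_cauchy_sum_eq_zero (x := γ) (y := fun i : Fin N => eigenvalue α (i + 1))
    (a := fun i => normalDeriv N i * x i) hγ (fun i j hij => Fin.ext (by
      have := eigenvalue_injective α hij; omega)) hne (fun k => by
      have := congrFun hx k
      simp only [Matrix.mulVecLin_apply, Matrix.mulVec, dotProduct, Matrix.transpose_apply,
        colMat, Matrix.of_apply, Pi.zero_apply] at this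
      rw [← this]
      exact Finset.sum_congr rfl fun i _ => by ring)
  ext i
  have := congrFun h0 i
  simpa [normalDeriv_ne_zero] using this

/-- The `k`-th column of `colMat` is an eigenvector, for `γ k`, of `Λ + b ⊗ (feedback)`. -/
lemma eigenvalue_mul_colMat {α : ℝ} {N : ℕ} {γ : Fin N → ℝ}
    (hne : ∀ (k i : Fin N), γ k ≠ eigenvalue α (i + 1)) (i k : Fin N) :
    eigenvalue α (i + 1) * colMat α N γ i k + normalDeriv N i = γ k * colMat α N γ i k := by
  have := sub_ne_zero.2 (hne k i)
  simp only [colMat, Matrix.of_apply]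
  field_simp
  ring

/-- The coordinates of the low modes in the basis that diagonalises the closed loop. -/
def loopCoord (α : ℝ) (N : ℕ) (γ : Fin N → ℝ) (m : Fin N → ℝ) : Fin N → ℝ :=
  Matrix.mulVec (colMat α N γ)⁻¹ m

/-- With `P` the column matrix, `F_k(u)` is the `k`-th entry of `Pᵀ (P Pᵀ)⁻¹ m = P⁻¹ m`. -/
lemma feedback_eq {α : ℝ} {N : ℕ} {γ : Fin N → ℝ} (hP : IsUnit (colMat α N γ)) (u : L2) :
    feedback α N γ u = ∑ k, loopCoord α N γ (moments N u) k := by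
  refine Finset.sum_congr rfl fun k _ => ?_
  have hdet := (Matrix.isUnit_iff_isUnit_det _).1 hP
  have hdet' := (Matrix.isUnit_iff_isUnit_det _).1 ((Matrix.isUnit_transpose _).2 hP)
  have h1 : feedbackPart α N γ k u =
      Matrix.mulVec (colMat α N γ).transpose (Matrix.mulVec (sumB α N γ)⁻¹ (moments N u)) k := by
    rw [feedbackPart, dotProduct_comm]
    rfl
  rw [h1, sumB_eq, Matrix.mul_inv_rev, Matrix.mulVec_mulVec, ← Matrix.mul_assoc,
    Matrix.mul_nonsing_inv _ hdet', Matrix.one_mul, loopCoord]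

lemma colMat_mulVec_loopCoord {α : ℝ} {N : ℕ} {γ : Fin N → ℝ} (hP : IsUnit (colMat α N γ))
    (m : Fin N → ℝ) : Matrix.mulVec (colMat α N γ) (loopCoord α N γ m) = m := by
  rw [loopCoord, Matrix.mulVec_mulVec,
    Matrix.mul_nonsing_inv _ ((Matrix.isUnit_iff_isUnit_det _).1 hP), Matrix.one_mulVec]

lemma loopCoord_colMat_mulVec {α : ℝ} {N : ℕ} {γ : Fin N → ℝ} (hP : IsUnit (colMat α N γ))
    (w : Fin N → ℝ) : loopCoord α N γ (Matrix.mulVec (colMat α N γ) w) = w := by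
  rw [loopCoord, Matrix.mulVec_mulVec,
    Matrix.nonsing_inv_mul _ ((Matrix.isUnit_iff_isUnit_det _).1 hP), Matrix.one_mulVec]

/-- In the diagonalising coordinates the closed-loop vector field is `-diag γ`. -/
lemma loopCoord_field {α : ℝ} {N : ℕ} {γ : Fin N → ℝ} (hP : IsUnit (colMat α N γ))
    (hne : ∀ (k i : Fin N), γ k ≠ eigenvalue α (i + 1)) (m : Fin N → ℝ) :
    loopCoord α N γ (fun i => -eigenvalue α (i + 1) * m i -
      normalDeriv N i * ∑ k, loopCoord α N γ m k) = fun k => -γ k * loopCoord α N γ m k := by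
  set w := loopCoord α N γ m with hw
  rw [← loopCoord_colMat_mulVec hP (fun k => -γ k * w k)]
  congr 1
  ext i
  have hm : m i = ∑ k, colMat α N γ i k * w k := by
    rw [← congrFun (colMat_mulVec_loopCoord hP m) i]; rfl
  rw [hm, Matrix.mulVec, dotProduct, Finset.mul_sum, Finset.mul_sum, ← Finset.sum_sub_distrib]
  refine Finset.sum_congr rfl fun k _ => ?_
  linear_combination (-w k) * eigenvalue_mul_colMat hne i k

lemma exists_mulVec_bound {N : ℕ} (P : Matrix (Fin N) (Fin N) ℝ) :
    ∃ A : ℝ, 0 ≤ A ∧ ∀ (m : Fin N → ℝ) (M : ℝ), (∀ i, |m i| ≤ M) → ∀ k,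
      |Matrix.mulVec P m k| ≤ A * M := by
  refine ⟨∑ k, ∑ i, |P k i|, by positivity, fun m M hm k => ?_⟩
  have hM : 0 ≤ M := (abs_nonneg _).trans (hm k)
  calc |Matrix.mulVec P m k| ≤ ∑ i, |P k i * m i| := by
        rw [Matrix.mulVec, dotProduct]; exact Finset.abs_sum_le_sum_abs _ _
    _ ≤ ∑ i, |P k i| * M := by
        gcongr with i; rw [abs_mul]; gcongr; exact hm i
    _ = (∑ i, |P k i|) * M := by rw [Finset.sum_mul]
    _ ≤ _ := mul_le_mul_of_nonneg_right
        (Finset.single_le_sum (f := fun k => ∑ i, |P k i|)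
          (fun _ _ => by positivity) (Finset.mem_univ k)) hM

/-! ### Coefficient equations: decay -/

/-- Growth bound for a damped scalar equation with exponentially decaying forcing. -/
lemma abs_le_of_hasDerivWithinAt_damped {y U : ℝ → ℝ} {l b K μ : ℝ} (hμ : μ < l) (hc : ContinuousOn y (Ici 0))
    (hy : ∀ t, 0 ≤ t → HasDerivWithinAt y (-l * y t - b * U t) (Ici t) t)
    (hU : ∀ t, 0 ≤ t → |U t| ≤ K * Real.exp (-μ * t)) {t : ℝ} (ht : 0 ≤ t) :
    |y t| ≤ Real.exp (-μ * t) * (|y 0| + |b| * K / (l - μ)) := by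
  have hlm : 0 < l - μ := sub_pos.2 hμ
  have hK : 0 ≤ K := by simpa using (abs_nonneg _).trans (hU 0 le_rfl)
  have hexp : ∀ (c s : ℝ), HasDerivAt (fun r => Real.exp (c * r)) (c * Real.exp (c * s)) s := by
    intro c s
    have := ((hasDerivAt_id s).const_mul c).exp
    simpa [mul_comm] using this
  -- The integrating factor `exp(l s)` removes the damping; the derivative left over is at most `|b|
  -- K exp((l - μ) s)`, which integrates to the comparison function.
  have key := image_norm_le_of_norm_deriv_right_le_deriv_boundary
    (f := fun s => Real.exp (l * s) * y s) (a := 0) (b := t)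
    (f' := fun s => -b * Real.exp (l * s) * U s)
    (B := fun s => |y 0| + |b| * K / (l - μ) * Real.exp ((l - μ) * s))
    (B' := fun s => |b| * K * Real.exp ((l - μ) * s))
    (((by fun_prop : Continuous fun s => Real.exp (l * s)).continuousOn).mul
      (hc.mono Icc_subset_Ici_self))
    (fun s hs => by
      refine ((hexp l s).hasDerivWithinAt.mul (hy s hs.1)).congr_deriv ?_
      ring)
    (by simp; positivity)
    (fun s => by
      refine (((hexp (l - μ) s).const_mul (|b| * K / (l - μ))).const_add (|y 0|)).congr_deriv ?_
      field_simp)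
    (fun s hs => by
      have e : Real.exp ((l - μ) * s) = Real.exp (l * s) * Real.exp (-μ * s) := by
        rw [← Real.exp_add]; ring_nf
      rw [Real.norm_eq_abs, abs_mul, abs_mul, abs_neg, Real.abs_exp, e]
      calc |b| * Real.exp (l * s) * |U s| ≤ |b| * Real.exp (l * s) * (K * Real.exp (-μ * s)) := by
            gcongr; exact hU s hs.1
        _ = _ := by ring)
    (right_mem_Icc.2 ht)
  simp only [Real.norm_eq_abs, abs_mul, Real.abs_exp] at key
  have e1 : Real.exp (-l * t) * Real.exp (l * t) = 1 := by rw [← Real.exp_add]; simp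
  have e2 : Real.exp (-l * t) * Real.exp ((l - μ) * t) = Real.exp (-μ * t) := by
    rw [← Real.exp_add]; ring_nf
  have h3 : Real.exp (-l * t) ≤ Real.exp (-μ * t) := Real.exp_le_exp.2 (by nlinarith)
  calc |y t| = Real.exp (-l * t) * (Real.exp (l * t) * |y t|) := by rw [← mul_assoc, e1, one_mul]
    _ ≤ Real.exp (-l * t) * (|y 0| + |b| * K / (l - μ) * Real.exp ((l - μ) * t)) := by gcongr
    _ = Real.exp (-l * t) * |y 0| + |b| * K / (l - μ) * Real.exp (-μ * t) := by
        rw [← e2]; ring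
    _ ≤ Real.exp (-μ * t) * |y 0| + |b| * K / (l - μ) * Real.exp (-μ * t) := by gcongr
    _ = _ := by ring

/-- The equations for the coefficients of a closed-loop solution. -/
structure IsModalFlow (α : ℝ) (N : ℕ) (γ : Fin N → ℝ) (m : ℕ → ℝ → ℝ) (U : ℝ → ℝ) : Prop where
  continuousOn : ∀ j, ContinuousOn (m j) (Ici 0)
  hasDeriv : ∀ j t, 0 ≤ t → HasDerivWithinAt (m j)
    (-eigenvalue α (j + 1) * m j t - deriv (mode (j + 1)) 1 * U t) (Ici t) t
  input : ∀ t, 0 ≤ t → U t = ∑ k, loopCoord α N γ (fun i => m i t) k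

variable {α ρ : ℝ} {N : ℕ} {γ : Fin N → ℝ} {m : ℕ → ℝ → ℝ} {U : ℝ → ℝ}

/-- By `loopCoord_field` each coordinate satisfies `w' = -γ_k w`, so `exp(γ_k t) w` is constant. -/
lemma IsModalFlow.loopCoord_eq (h : IsModalFlow α N γ m U) (hP : IsUnit (colMat α N γ))
    (hne : ∀ (k i : Fin N), γ k ≠ eigenvalue α (i + 1)) (k : Fin N) {t : ℝ} (ht : 0 ≤ t) :
    loopCoord α N γ (fun i => m i t) k =
      Real.exp (-γ k * t) * loopCoord α N γ (fun i => m i 0) k := by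
  set w : ℝ → ℝ := fun s => loopCoord α N γ (fun i => m i s) k with hw
  have hwd : ∀ s, 0 ≤ s → HasDerivWithinAt w (-γ k * w s) (Ici s) s := by
    intro s hs
    have h1 : HasDerivWithinAt w (loopCoord α N γ (fun i => -eigenvalue α (i + 1) * m i s -
        normalDeriv N i * U s) k) (Ici s) s := by
      simp only [hw, loopCoord, Matrix.mulVec, dotProduct]
      exact HasDerivWithinAt.fun_sum fun i _ => (h.hasDeriv i s hs).const_mul _
    rw [h.input s hs, loopCoord_field hP hne] at h1
    exact h1
  have hwc : ContinuousOn w (Ici 0) := by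
    simp only [hw, loopCoord, Matrix.mulVec, dotProduct]
    exact continuousOn_finsetSum _ fun i _ => (h.continuousOn i).const_mul _
  have key := constant_of_has_deriv_right_zero (f := fun s => Real.exp (γ k * s) * w s)
    (a := 0) (b := t)
    (((by fun_prop : Continuous fun s => Real.exp (γ k * s)).continuousOn).mul
      (hwc.mono Icc_subset_Ici_self))
    (fun s hs => by
      have h1 : HasDerivAt (fun r => Real.exp (γ k * r)) (γ k * Real.exp (γ k * s)) s := by
        have := ((hasDerivAt_id s).const_mul (γ k)).exp
        simpa [mul_comm] using this
      refine (h1.hasDerivWithinAt.mul (hwd s hs.1)).congr_deriv ?_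
      ring) t (right_mem_Icc.2 ht)
  simp only [mul_zero, Real.exp_zero, one_mul] at key
  change w t = _ * w 0
  rw [← key, ← mul_assoc, ← Real.exp_add]
  simp

/-- Above the threshold `ρ`, the eigenvalue controls `(πj)² = λ_j + α` up to the factor `1 + α/ρ`.
This makes the response of the high modes to the input decay like `1/j`. -/
lemma eigenvalue_lower_bound (hα : 0 < α) {j : ℕ} (hj : ρ ≤ eigenvalue α j) :
    (Real.pi * j) ^ 2 * ρ ≤ eigenvalue α j * (ρ + α) := by
  unfold eigenvalue at *
  nlinarith

/-- The summand `K M / (j + 1)` measures the effect of the feedback; its decay in `j` keeps the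
bound square-summable. The rate is `ρ/2` rather than `ρ` because `λ_j = ρ` is possible for a high
mode and the gap `λ_j - ρ/2` must stay positive. -/
lemma exists_modalFlow_bound (hα : 0 < α) (hρ : 0 < ρ)
    (hN : ∀ j : ℕ, 1 ≤ j → (eigenvalue α j < ρ ↔ j ≤ N)) (hργ : ∀ k, ρ < γ k)
    (hP : IsUnit (colMat α N γ)) (hne : ∀ (k i : Fin N), γ k ≠ eigenvalue α (i + 1)) :
    ∃ K : ℝ, 0 ≤ K ∧ ∀ (m : ℕ → ℝ → ℝ) (U : ℝ → ℝ), IsModalFlow α N γ m U → ∀ M : ℝ,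
      (∀ j, |m j 0| ≤ M) → ∀ t, 0 ≤ t → |U t| ≤ K * M * Real.exp (-(ρ / 2) * t) ∧
        ∀ j, |m j t| ≤ Real.exp (-(ρ / 2) * t) * (|m j 0| + K * M / (j + 1)) := by
  obtain ⟨A₁, hA₁, hb₁⟩ := exists_mulVec_bound (colMat α N γ)⁻¹
  obtain ⟨A₂, hA₂, hb₂⟩ := exists_mulVec_bound (colMat α N γ)
  have hπ := Real.pi_pos
  -- From `λ - ρ/2 ≥ λ/2` and the lower bound on `λ`, the gain `π(j+1) / (λ - ρ/2)` is at most `c /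
  -- (j+1)`.
  set c := 2 * (ρ + α) / (ρ * Real.pi) with hc
  have hc0 : 0 < c := by positivity
  -- The three terms serve the input, the high modes and the low modes. In the last, the factor `N`
  -- pays for `1 / (j+1)`, since `j + 1 ≤ N` there.
  refine ⟨N * A₁ + N * A₁ * c + N * (A₂ * A₁), by positivity, fun m U h M hM => ?_⟩
  have hM0 : 0 ≤ M := (abs_nonneg _).trans (hM 0)
  have hw : ∀ t, 0 ≤ t → ∀ k, |loopCoord α N γ (fun i => m i t) k| ≤
      A₁ * (Real.exp (-(ρ / 2) * t) * M) := by
    intro t ht k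
    rw [h.loopCoord_eq hP hne k ht, abs_mul, Real.abs_exp]
    calc _ ≤ Real.exp (-(ρ / 2) * t) * (A₁ * M) := by
          gcongr
          · nlinarith [hργ k]
          · exact hb₁ _ M (fun i => hM i) k
      _ = _ := by ring
  have hU : ∀ t, 0 ≤ t → |U t| ≤ N * A₁ * M * Real.exp (-(ρ / 2) * t) := by
    intro t ht
    rw [h.input t ht]
    refine (Finset.abs_sum_le_sum_abs _ _).trans ((Finset.sum_le_sum fun k _ => hw t ht k).trans ?_)
    simp only [Finset.sum_const, Finset.card_univ, Fintype.card_fin, nsmul_eq_mul]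
    exact le_of_eq (by ring)
  intro t ht
  refine ⟨(hU t ht).trans ?_, fun j => ?_⟩
  · gcongr
    have : 0 ≤ N * A₁ * c + N * (A₂ * A₁) := by positivity
    linarith
  · rcases lt_or_ge j N with hj | hj
    · have h1 := hb₂ _ _ (hw t ht) ⟨j, hj⟩
      rw [colMat_mulVec_loopCoord hP] at h1
      have h2 : A₂ * A₁ * M ≤ (N * A₁ + N * A₁ * c + N * (A₂ * A₁)) * M / (j + 1) := by
        rw [le_div_iff₀ (by positivity)]
        have hj' : (j : ℝ) + 1 ≤ N := by exact_mod_cast hj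
        have h3 : A₂ * A₁ * M * (j + 1) ≤ A₂ * A₁ * M * N := by gcongr
        have h4 : 0 ≤ (N * A₁ + N * A₁ * c) * M := by positivity
        nlinarith
      calc |m j t| ≤ Real.exp (-(ρ / 2) * t) * (A₂ * A₁ * M) := by
            refine h1.trans (le_of_eq ?_); ring
        _ ≤ _ := by
            gcongr
            exact h2.trans (le_add_of_nonneg_left (abs_nonneg _))
    · have hl : ρ ≤ eigenvalue α (j + 1) := by
        rw [← not_lt, hN (j + 1) (by omega)]; omega
      have hlow := eigenvalue_lower_bound hα hl
      refine (abs_le_of_hasDerivWithinAt_damped (μ := ρ / 2) (K := N * A₁ * M) (by linarith)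
        (h.continuousOn j) (h.hasDeriv j) hU ht).trans ?_
      rw [abs_deriv_mode_one]
      refine mul_le_mul_of_nonneg_left (add_le_add le_rfl ?_) (Real.exp_nonneg _)
      rw [div_le_div_iff₀ (by linarith) (by positivity)]
      have h5 : Real.pi * ((j + 1 : ℕ) : ℝ) * ((j : ℝ) + 1) ≤ c * (eigenvalue α (j + 1) - ρ / 2) := by
        rw [hc, div_mul_eq_mul_div, le_div_iff₀ (by positivity)]
        push_cast at hlow ⊢
        nlinarith
      calc Real.pi * ((j + 1 : ℕ) : ℝ) * (N * A₁ * M) * ((j : ℝ) + 1)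
          = N * A₁ * M * (Real.pi * ((j + 1 : ℕ) : ℝ) * ((j : ℝ) + 1)) := by ring
        _ ≤ N * A₁ * M * (c * (eigenvalue α (j + 1) - ρ / 2)) := by gcongr
        _ = N * A₁ * c * M * (eigenvalue α (j + 1) - ρ / 2) := by ring
        _ ≤ _ := by
          have : 0 ≤ eigenvalue α (j + 1) - ρ / 2 := by linarith
          gcongr
          have h6 : 0 ≤ N * A₁ := by positivity
          have h7 : 0 ≤ N * (A₂ * A₁) := by positivity
          linarith

/-! ### Coefficient equations: existence -/

lemma exists_hasDerivAt_damped (l b y₀ : ℝ) (hU : Continuous U) :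
    ∃ y : ℝ → ℝ, y 0 = y₀ ∧ ∀ t, HasDerivAt y (-l * y t - b * U t) t := by
  refine ⟨fun t => Real.exp (-l * t) * (y₀ - b * ∫ s in (0 : ℝ)..t, Real.exp (l * s) * U s),
    by simp, fun t => ?_⟩
  have h1 : HasDerivAt (fun r => Real.exp (-l * r)) (-l * Real.exp (-l * t)) t := by
    have := ((hasDerivAt_id t).const_mul (-l)).exp
    simpa [mul_comm] using this
  have h2 : HasDerivAt (fun r => ∫ s in (0 : ℝ)..r, Real.exp (l * s) * U s)
      (Real.exp (l * t) * U t) t :=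
    (Continuous.integral_hasStrictDerivAt (by fun_prop) 0 t).hasDerivAt
  refine (h1.mul ((h2.const_mul b).const_sub y₀)).congr_deriv ?_
  have e1 : Real.exp (-l * t) * Real.exp (l * t) = 1 := by rw [← Real.exp_add]; simp
  linear_combination -(b * U t) * e1

/-- The closed-loop coefficient equations are solvable for arbitrary initial coefficients. -/
lemma exists_modalFlow (hP : IsUnit (colMat α N γ))
    (hne : ∀ (k i : Fin N), γ k ≠ eigenvalue α (i + 1)) (m₀ : ℕ → ℝ) :
    ∃ (m : ℕ → ℝ → ℝ) (U : ℝ → ℝ), IsModalFlow α N γ m U ∧ Continuous U ∧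
      (∀ j, m j 0 = m₀ j) ∧ ∀ j t, HasDerivAt (m j)
        (-eigenvalue α (j + 1) * m j t - deriv (mode (j + 1)) 1 * U t) t := by
  -- The loop is solved in diagonal coordinates first: `w` determines `U`, then the low modes are `P
  -- w`, and each high mode is a scalar equation with known input `U`.
  set w : Fin N → ℝ → ℝ := fun k t =>
    Real.exp (-γ k * t) * loopCoord α N γ (fun i => m₀ i) k with hw
  set U : ℝ → ℝ := fun t => ∑ k, w k t with hU
  have hwd : ∀ k t, HasDerivAt (w k) (-γ k * w k t) t := by
    intro k t
    have h1 : HasDerivAt (fun r => Real.exp (-γ k * r)) (-γ k * Real.exp (-γ k * t)) t := by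
      have := ((hasDerivAt_id t).const_mul (-γ k)).exp
      simpa [mul_comm] using this
    refine (h1.mul_const (loopCoord α N γ (fun i => m₀ i) k)).congr_deriv ?_
    simp only [hw]; ring
  have hUc : Continuous U := by
    simp only [hU, hw]; fun_prop
  choose z hz0 hz using fun j : ℕ =>
    exists_hasDerivAt_damped (eigenvalue α (j + 1)) (deriv (mode (j + 1)) 1) (m₀ j) hUc
  set m : ℕ → ℝ → ℝ := fun j => if h : j < N then
    fun t => Matrix.mulVec (colMat α N γ) (fun k => w k t) ⟨j, h⟩ else z j with hm
  have hlow : ∀ (i : Fin N) t, m i t = Matrix.mulVec (colMat α N γ) (fun k => w k t) i := by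
    intro i t; simp [hm]
  have hloop : ∀ t, loopCoord α N γ (fun i => m i t) = fun k => w k t := by
    intro t
    simp only [hlow]
    exact loopCoord_colMat_mulVec hP _
  have hd : ∀ j t, HasDerivAt (m j)
      (-eigenvalue α (j + 1) * m j t - deriv (mode (j + 1)) 1 * U t) t := by
    intro j t
    by_cases hj : j < N
    · have e : m j = fun t => Matrix.mulVec (colMat α N γ) (fun k => w k t) ⟨j, hj⟩ := by
        simp only [hm, dif_pos hj]
      have h1 : HasDerivAt (m j)
          (Matrix.mulVec (colMat α N γ) (fun k => -γ k * w k t) ⟨j, hj⟩) t := by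
        rw [e]
        simp only [Matrix.mulVec, dotProduct]
        exact HasDerivAt.fun_sum fun k _ => (hwd k t).const_mul _
      refine h1.congr_deriv ?_
      -- Applying `P` to the diagonalised vector field returns the original equations of the low
      -- modes.
      have h2 := congrArg (Matrix.mulVec (colMat α N γ)) (loopCoord_field hP hne (fun i => m i t))
      rw [colMat_mulVec_loopCoord hP, hloop] at h2
      exact (congrFun h2 ⟨j, hj⟩).symm
    · have e : m j = z j := by simp only [hm, dif_neg hj]
      rw [e]; exact hz j t
  refine ⟨m, U, ⟨fun j t _ => (hd j t).continuousAt.continuousWithinAt,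
    fun j t _ => (hd j t).hasDerivWithinAt, fun t _ => by rw [hloop]⟩, hUc, fun j => ?_, hd⟩
  by_cases hj : j < N
  · have h1 := hlow ⟨j, hj⟩ 0
    have h2 : (fun k => w k 0) = loopCoord α N γ (fun i => m₀ i) := by ext k; simp [hw]
    rw [h2, colMat_mulVec_loopCoord hP] at h1
    exact h1
  · simp only [hm, dif_neg hj]; exact hz0 j

/-! ### From solutions to coefficient equations -/

lemma contDiff_mode (j : ℕ) : ContDiff ℝ 2 (mode j) := by
  unfold mode; fun_prop

lemma mode_zero_right (j : ℕ) : mode j 0 = 0 := by simp [mode]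

lemma mode_one_right (j : ℕ) : mode j 1 = 0 := by
  rw [mode, mul_one, mul_comm, Real.sin_nat_mul_pi]

lemma deriv_deriv_mode (j : ℕ) (x : ℝ) : deriv (deriv (mode j)) x = -(Real.pi * j) ^ 2 * mode j x := by
  have h1 : deriv (mode j) = fun x => Real.pi * j * Real.cos (Real.pi * j * x) :=
    funext fun x => (hasDerivAt_mode j x).deriv
  rw [h1]
  have h := ((Real.hasDerivAt_cos (Real.pi * j * x)).comp x
    ((hasDerivAt_id x).const_mul (Real.pi * j))).const_mul (Real.pi * j)
  refine Eq.trans h.deriv ?_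
  rw [mode]; ring

/-- The integrand is controlled only for `s ≥ 0`; replacing it by `f (max s 0)` gives a continuous
function on the line without changing the integral, so the fundamental theorem applies even at `t =
0`. -/
lemma hasDerivWithinAt_of_eq_integral {y f : ℝ → ℝ} {c : ℝ} (hf : ContinuousOn f (Ici 0))
    (hy : ∀ t, 0 ≤ t → y t = c + ∫ s in (0 : ℝ)..t, f s) {t : ℝ} (ht : 0 ≤ t) :
    HasDerivWithinAt y (f t) (Ici t) t := by
  have hg : Continuous fun s => f (max s 0) :=
    hf.comp_continuous (by fun_prop) fun s => le_max_right s 0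
  have h1 : HasDerivAt (fun r => c + ∫ s in (0 : ℝ)..r, f (max s 0)) (f (max t 0)) t :=
    ((hg.integral_hasStrictDerivAt 0 t).hasDerivAt).const_add c
  rw [max_eq_left ht] at h1
  have e : ∀ r, 0 ≤ r → y r = c + ∫ s in (0 : ℝ)..r, f (max s 0) := by
    intro r hr
    rw [hy r hr]
    congr 1
    refine intervalIntegral.integral_congr fun s hs => ?_
    rw [uIcc_of_le hr] at hs
    simp [max_eq_left hs.1]
  exact h1.hasDerivWithinAt.congr (fun r hr => e r (ht.trans hr)) (e t ht)

lemma continuousOn_pairing {u : ℝ → L2} {s : Set ℝ} (hu : ContinuousOn u s) {φ : ℝ → ℝ}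
    (hφ : Continuous φ) : ContinuousOn (fun t => pairing (u t) φ) s := by
  simp only [pairing_eq_inner hφ]
  exact continuousOn_const.inner hu

lemma continuousOn_feedback {u : ℝ → L2} {s : Set ℝ} (hu : ContinuousOn u s) :
    ContinuousOn (fun t => feedback α N γ (u t)) s := by
  have := fun i : Fin N => continuousOn_pairing hu (continuous_mode (i + 1))
  unfold feedback feedbackPart moments
  simp only [Matrix.mulVec, dotProduct]
  fun_prop

lemma IsClosedLoopSolution.isModalFlow (hP : IsUnit (colMat α N γ)) {u₀ : L2} {u : ℝ → L2}
    (hu : IsClosedLoopSolution α N γ u₀ u) :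
    IsModalFlow α N γ (fun j t => pairing (u t) (mode (j + 1))) (fun t => feedback α N γ (u t)) := by
  have hc : ∀ j, ContinuousOn (fun t => pairing (u t) (mode j)) (Ici 0) := fun j =>
    continuousOn_pairing hu.continuousOn (continuous_mode j)
  have hF : ContinuousOn (fun t => feedback α N γ (u t)) (Ici 0) :=
    continuousOn_feedback hu.continuousOn
  refine ⟨fun j => hc _, fun j t ht => ?_, fun t _ => feedback_eq hP (u t)⟩
  refine hasDerivWithinAt_of_eq_integral (f := fun s => -eigenvalue α (j + 1) *
    pairing (u s) (mode (j + 1)) - deriv (mode (j + 1)) 1 * feedback α N γ (u s))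
    (c := pairing u₀ (mode (j + 1))) (by have := hc (j + 1); fun_prop) (fun t ht => ?_) ht
  rw [hu.weak _ (contDiff_mode (j + 1)) (mode_zero_right _) (mode_one_right _) t ht]
  congr 2
  ext s
  have e : (fun x => deriv (deriv (mode (j + 1))) x + α * mode (j + 1) x) =
      fun x => -eigenvalue α (j + 1) * mode (j + 1) x := by
    ext x; rw [deriv_deriv_mode, eigenvalue]; ring
  rw [e, pairing_const_mul, mul_comm (feedback α N γ (u s))]

lemma IsBoundarySolution.sub {U V : ℝ → ℝ} {u₀ v₀ : L2} {u v : ℝ → L2}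
    (hu : IsBoundarySolution α U u₀ u) (hv : IsBoundarySolution α V v₀ v)
    (hU : ContinuousOn U (Ici 0)) (hV : ContinuousOn V (Ici 0)) :
    IsBoundarySolution α (fun t => U t - V t) (u₀ - v₀) (fun t => u t - v t) := by
  refine ⟨hu.continuousOn.sub hv.continuousOn, by rw [hu.initial, hv.initial], ?_⟩
  intro φ hφ h0 h1 t ht
  have hc2 : Continuous fun x => deriv (deriv φ) x + α * φ x := by
    have h1 := (hφ.iterate_deriv' 0 2).continuous
    simp only [Function.iterate_succ, Function.iterate_zero, Function.comp_def] at h1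
    exact h1.add (hφ.continuous.const_mul α)
  have hint : ∀ {W : ℝ → ℝ} {w : ℝ → L2}, ContinuousOn W (Ici 0) → ContinuousOn w (Ici 0) →
      IntervalIntegrable (fun s => pairing (w s) (fun x => deriv (deriv φ) x + α * φ x) -
        W s * deriv φ 1) volume 0 t := by
    intro W w hW hw
    refine ContinuousOn.intervalIntegrable ?_
    rw [uIcc_of_le ht]
    exact ((continuousOn_pairing hw hc2).sub (hW.mul continuousOn_const)).mono Icc_subset_Ici_self
  rw [pairing_sub hφ.continuous, pairing_sub hφ.continuous, hu.weak φ hφ h0 h1 t ht,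
    hv.weak φ hφ h0 h1 t ht, add_sub_add_comm,
    ← intervalIntegral.integral_sub (hint hU hu.continuousOn) (hint hV hv.continuousOn)]
  congr 2
  ext s
  rw [pairing_sub hc2]; ring

lemma IsClosedLoopSolution.sub (hP : IsUnit (colMat α N γ)) {u₀ v₀ : L2} {u v : ℝ → L2}
    (hu : IsClosedLoopSolution α N γ u₀ u) (hv : IsClosedLoopSolution α N γ v₀ v) :
    IsClosedLoopSolution α N γ (u₀ - v₀) (fun t => u t - v t) := by
  have h := IsBoundarySolution.sub hu hv (continuousOn_feedback hu.continuousOn)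
    (continuousOn_feedback hv.continuousOn)
  have e : ∀ x y : L2, feedback α N γ (x - y) = feedback α N γ x - feedback α N γ y := by
    intro x y
    have : moments N (x - y) = moments N x - moments N y := by
      ext i; exact pairing_sub (continuous_mode _) x y
    rw [feedback_eq hP, feedback_eq hP, feedback_eq hP, this, ← Finset.sum_sub_distrib]
    simp only [loopCoord, Matrix.mulVec_sub, Pi.sub_apply]
  unfold IsClosedLoopSolution
  simpa only [e] using h

/-! ### Decay in `L²(0,1)` -/

lemma summable_one_div_succ_sq : Summable fun j : ℕ => 1 / ((j : ℝ) + 1) ^ 2 := by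
  have := (summable_nat_add_iff 1).2 (Real.summable_one_div_nat_pow.2 (one_lt_two))
  simpa using this

/-- Exponential decay of all closed-loop solutions. -/
lemma exists_decay (hα : 0 < α) (hρ : 0 < ρ)
    (hN : ∀ j : ℕ, 1 ≤ j → (eigenvalue α j < ρ ↔ j ≤ N)) (hργ : ∀ k, ρ < γ k)
    (hP : IsUnit (colMat α N γ)) (hne : ∀ (k i : Fin N), γ k ≠ eigenvalue α (i + 1)) :
    ∃ C : ℝ, 0 < C ∧ ∀ (u₀ : L2) (u : ℝ → L2), IsClosedLoopSolution α N γ u₀ u →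
      ∀ t : ℝ, 0 ≤ t → ‖u t‖ ≤ C * Real.exp (-(ρ / 2) * t) * ‖u₀‖ := by
  obtain ⟨K, hK, hb⟩ := exists_modalFlow_bound hα hρ hN hργ hP hne
  set S := ∑' j : ℕ, 1 / ((j : ℝ) + 1) ^ 2 with hS
  have hS0 : 0 ≤ S := tsum_nonneg fun j => by positivity
  -- This constant comes from `(a + b)² ≤ 2a² + 2b²` on each coefficient, summed with the Parseval
  -- weight `2`.
  refine ⟨√(2 + 4 * K ^ 2 * S), by positivity, fun u₀ u hu t ht => ?_⟩
  have h0 : u 0 = u₀ := hu.initial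
  have hm := (hb _ _ (hu.isModalFlow hP) ‖u₀‖ (fun j => by
    rw [h0]; exact abs_pairing_mode_le u₀ j) t ht).2
  simp only [h0] at hm
  set E := Real.exp (-(ρ / 2) * t) with hE
  have hE0 : 0 < E := Real.exp_pos _
  have hle : ‖u t‖ ^ 2 ≤ E ^ 2 * (2 * ‖u₀‖ ^ 2 + 4 * (K * ‖u₀‖) ^ 2 * S) := by
    refine hasSum_le (fun j => ?_) (hasSum_sq_pairing (u t))
      ((((hasSum_sq_pairing u₀).mul_left 2).add
        (summable_one_div_succ_sq.hasSum.mul_left (4 * (K * ‖u₀‖) ^ 2))).mul_left (E ^ 2))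
    have h1 : pairing (u t) (mode (j + 1)) ^ 2 ≤
        (E * (|pairing u₀ (mode (j + 1))| + K * ‖u₀‖ / (j + 1))) ^ 2 := by
      rw [← sq_abs (pairing (u t) _)]
      exact pow_le_pow_left₀ (abs_nonneg _) (hm j) 2
    have h2 : (|pairing u₀ (mode (j + 1))| + K * ‖u₀‖ / (j + 1)) ^ 2 ≤
        2 * pairing u₀ (mode (j + 1)) ^ 2 + 2 * ((K * ‖u₀‖) ^ 2 * (1 / ((j : ℝ) + 1) ^ 2)) := by
      rw [← sq_abs (pairing u₀ _)]
      refine add_sq_le.trans (le_of_eq ?_)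
      rw [div_pow]; ring
    calc 2 * pairing (u t) (mode (j + 1)) ^ 2
        ≤ 2 * (E ^ 2 * (2 * pairing u₀ (mode (j + 1)) ^ 2 +
          2 * ((K * ‖u₀‖) ^ 2 * (1 / ((j : ℝ) + 1) ^ 2)))) := by
          rw [mul_pow] at h1
          gcongr
          exact h1.trans (by gcongr)
      _ = _ := by ring
  refine le_of_sq_le_sq ?_ (by positivity)
  rw [mul_pow, mul_pow, Real.sq_sqrt (by positivity)]
  exact hle.trans (le_of_eq (by ring))

/-! ### Sine series of test functions -/

lemma hasDerivAt_of_contDiff_two {φ : ℝ → ℝ} (hφ : ContDiff ℝ 2 φ) (x : ℝ) :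
    HasDerivAt φ (deriv φ x) x ∧ HasDerivAt (deriv φ) (deriv (deriv φ) x) x := by
  have h1 : ContDiff ℝ 1 (deriv φ) := hφ.deriv'
  exact ⟨(hφ.differentiable (by norm_num) x).hasDerivAt,
    (h1.differentiable (by norm_num) x).hasDerivAt⟩

lemma continuous_deriv_deriv {φ : ℝ → ℝ} (hφ : ContDiff ℝ 2 φ) : Continuous (deriv (deriv φ)) := by
  have h1 : ContDiff ℝ 1 (deriv φ) := hφ.deriv'
  exact h1.continuous_deriv le_rfl

/-- Green's identity: `φ' φ_j - φ φ_j'` vanishes at both endpoints. -/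
lemma sineCoeff_deriv_deriv {φ : ℝ → ℝ} (hφ : ContDiff ℝ 2 φ) (h0 : φ 0 = 0) (h1 : φ 1 = 0)
    (j : ℕ) : sineCoeff (deriv (deriv φ)) j = -(Real.pi * (j + 1 : ℕ)) ^ 2 * sineCoeff φ j := by
  have hc := continuous_deriv_deriv hφ
  have hcφ := hφ.continuous
  have hcm := continuous_mode (j + 1)
  have key := intervalIntegral.integral_eq_sub_of_hasDerivAt (a := 0) (b := 1)
    (f := fun x => deriv φ x * mode (j + 1) x - φ x * deriv (mode (j + 1)) x)
    (f' := fun x => deriv (deriv φ) x * mode (j + 1) x +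
      (Real.pi * (j + 1 : ℕ)) ^ 2 * (φ x * mode (j + 1) x))
    (fun x _ => by
      obtain ⟨d1, d2⟩ := hasDerivAt_of_contDiff_two hφ x
      obtain ⟨e1, e2⟩ := hasDerivAt_of_contDiff_two (contDiff_mode (j + 1)) x
      rw [deriv_deriv_mode] at e2
      refine ((d2.mul e1).sub (d1.mul e2)).congr_deriv ?_
      ring)
    (Continuous.intervalIntegrable (by fun_prop) _ _)
  rw [intervalIntegral.integral_add (Continuous.intervalIntegrable (by fun_prop) _ _)
    (Continuous.intervalIntegrable (by fun_prop) _ _), intervalIntegral.integral_const_mul] at key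
  simp only [h0, h1, mode_zero_right, mode_one_right, mul_zero, zero_mul, sub_self] at key
  unfold sineCoeff
  linarith

lemma sineCoeff_id (j : ℕ) : sineCoeff (fun x => x) j =
    -deriv (mode (j + 1)) 1 / (Real.pi * (j + 1 : ℕ)) ^ 2 := by
  have hp : Real.pi * ((j + 1 : ℕ) : ℝ) ≠ 0 := by have := Real.pi_pos; positivity
  have hcm := continuous_mode (j + 1)
  have key := intervalIntegral.integral_eq_sub_of_hasDerivAt (a := 0) (b := 1)
    (f := fun x => mode (j + 1) x - x * deriv (mode (j + 1)) x)
    (f' := fun x => (Real.pi * (j + 1 : ℕ)) ^ 2 * (x * mode (j + 1) x))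
    (fun x _ => by
      obtain ⟨e1, e2⟩ := hasDerivAt_of_contDiff_two (contDiff_mode (j + 1)) x
      rw [deriv_deriv_mode] at e2
      refine (e1.sub ((hasDerivAt_id x).mul e2)).congr_deriv ?_
      simp only [id]; ring)
    (Continuous.intervalIntegrable (by fun_prop) _ _)
  rw [intervalIntegral.integral_const_mul] at key
  simp only [mode_zero_right, mode_one_right, zero_mul, sub_zero, zero_sub, one_mul] at key
  rw [sineCoeff, eq_div_iff (pow_ne_zero 2 hp), ← key]
  ring

/-- Integration by parts gives `φ'(1) = ∫₀¹ φ''(x) x dx`, and Parseval applies to this integral. In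
the product of coefficients the factor `(π(j+1))²` from `φ''` cancels the one in the denominator for
`x`. -/
lemma hasSum_deriv_one {φ : ℝ → ℝ} (hφ : ContDiff ℝ 2 φ) (h0 : φ 0 = 0) (h1 : φ 1 = 0) :
    HasSum (fun j => 2 * sineCoeff φ j * deriv (mode (j + 1)) 1) (deriv φ 1) := by
  have hc := continuous_deriv_deriv hφ
  have h := hasSum_sineCoeff_mul hc continuous_id'
  have key := intervalIntegral.integral_eq_sub_of_hasDerivAt (a := 0) (b := 1)
    (f := fun x => deriv φ x * x - φ x) (f' := fun x => deriv (deriv φ) x * x)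
    (fun x _ => by
      obtain ⟨d1, d2⟩ := hasDerivAt_of_contDiff_two hφ x
      refine ((d2.mul (hasDerivAt_id x)).sub d1).congr_deriv ?_
      simp only [id]; ring)
    (Continuous.intervalIntegrable (by fun_prop) _ _)
  simp only [h0, h1, mul_zero, mul_one, sub_zero] at key
  rw [key] at h
  convert! h using 2 with j
  rw [sineCoeff_deriv_deriv hφ h0 h1, sineCoeff_id]
  have hp : Real.pi * ((j + 1 : ℕ) : ℝ) ≠ 0 := by have := Real.pi_pos; positivity
  field_simp

lemma summable_mul_of_sq {f g : ℕ → ℝ} (hf : Summable fun j => f j ^ 2)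
    (hg : Summable fun j => g j ^ 2) : Summable fun j => |f j| * |g j| := by
  refine (hf.add hg).of_nonneg_of_le (fun _ => by positivity) fun j => ?_
  nlinarith [sq_nonneg (|f j| - |g j|), sq_abs (f j), sq_abs (g j)]

/-! ### Reconstruction of a solution from its coefficients -/

/-- A curve in `L²(0,1)` whose sine coefficients solve the coefficient equations is a solution in
the sense of transposition. -/
lemma isBoundarySolution_of_coeff {u₀ : L2} {u : ℝ → L2} {U : ℝ → ℝ} {m : ℕ → ℝ → ℝ}
    {c : ℕ → ℝ} {K : ℝ} (hu : ContinuousOn u (Ici 0)) (h0 : u 0 = u₀) (hU : Continuous U)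
    (hm : ∀ j t, HasDerivAt (m j)
      (-eigenvalue α (j + 1) * m j t - deriv (mode (j + 1)) 1 * U t) t)
    (hum : ∀ t ∈ Ici (0 : ℝ), ∀ j, pairing (u t) (mode (j + 1)) = m j t)
    (hc : Summable fun j => c j ^ 2) (hmc : ∀ j, ∀ t ∈ Ici (0 : ℝ), |m j t| ≤ c j)
    (hUK : ∀ t, 0 ≤ t → |U t| ≤ K) : IsBoundarySolution α U u₀ u := by
  refine ⟨hu, h0, fun φ hφ hφ0 hφ1 t ht => ?_⟩
  have hmcont : ∀ j, Continuous (m j) := fun j =>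
    continuous_iff_continuousAt.2 fun t => (hm j t).continuousAt
  have hc2 : Continuous fun x => deriv (deriv φ) x + α * φ x :=
    (continuous_deriv_deriv hφ).add (hφ.continuous.const_mul α)
  have hcoef : ∀ j, sineCoeff (fun x => deriv (deriv φ) x + α * φ x) j =
      -eigenvalue α (j + 1) * sineCoeff φ j := by
    intro j
    rw [← pairing_ofContinuous hc2, pairing_eq_inner (continuous_mode _), inner_ofContinuous]
    have e : ∀ x, mode (j + 1) x * (deriv (deriv φ) x + α * φ x) =
        deriv (deriv φ) x * mode (j + 1) x + α * (φ x * mode (j + 1) x) := fun x => by ring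
    have i1 := continuous_deriv_deriv hφ
    have i2 := hφ.continuous
    have i3 := continuous_mode (j + 1)
    simp only [e]
    rw [intervalIntegral.integral_add (Continuous.intervalIntegrable (by fun_prop) _ _)
      (Continuous.intervalIntegrable (by fun_prop) _ _), intervalIntegral.integral_const_mul]
    change sineCoeff (deriv (deriv φ)) j + α * sineCoeff φ j = _
    rw [sineCoeff_deriv_deriv hφ hφ0 hφ1, eigenvalue]
    ring
  -- The integrand of the weak identity is the sum of the right-hand sides of the coefficient
  -- equations, weighted by the sine coefficients of `φ`.
  have hF : ∀ s, 0 ≤ s → HasSum (fun j => 2 * sineCoeff φ j *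
      (-eigenvalue α (j + 1) * m j s - deriv (mode (j + 1)) 1 * U s))
      (pairing (u s) (fun x => deriv (deriv φ) x + α * φ x) - U s * deriv φ 1) := by
    intro s hs
    have h1 := (hasSum_pairing hc2 (u s)).sub ((hasSum_deriv_one hφ hφ0 hφ1).mul_left (U s))
    convert! h1 using 2 with j
    rw [hcoef, hum s hs]
    ring
  have hsum1 : Summable fun j => |sineCoeff φ j * eigenvalue α (j + 1)| * |c j| := by
    have := summable_mul_of_sq (summable_sq_sineCoeff hc2) hc
    simp only [hcoef] at this
    convert! this using 3 with j
    rw [neg_mul, abs_neg, mul_comm]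
  -- The gain `φ_j'(1)` is of order `j`, so these terms are comparable to the coefficients of `φ''`
  -- times `1 / (j+1)`, a product of two square-summable sequences.
  have hsum2 : Summable fun j => |sineCoeff φ j * deriv (mode (j + 1)) 1| := by
    have h1 := summable_mul_of_sq (summable_sq_sineCoeff (continuous_deriv_deriv hφ))
      (g := fun j : ℕ => 1 / ((j : ℝ) + 1)) (by simpa [div_pow] using summable_one_div_succ_sq)
    refine h1.of_nonneg_of_le (fun _ => abs_nonneg _) fun j => ?_
    have hπ := Real.two_le_pi
    rw [sineCoeff_deriv_deriv hφ hφ0 hφ1, abs_mul, abs_mul, abs_neg, abs_deriv_mode_one,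
      abs_of_nonneg (sq_nonneg (Real.pi * ((j + 1 : ℕ) : ℝ))),
      abs_of_pos (by positivity : (0 : ℝ) < 1 / ((j : ℝ) + 1))]
    have e : (Real.pi * ((j + 1 : ℕ) : ℝ)) ^ 2 * |sineCoeff φ j| * (1 / ((j : ℝ) + 1)) =
        |sineCoeff φ j| * (Real.pi * ((j + 1 : ℕ) : ℝ)) * Real.pi := by
      push_cast; field_simp
    rw [e]
    exact le_mul_of_one_le_right (by positivity) (by linarith)
  have hsum := (hsum1.mul_left 2).add (hsum2.mul_left (2 * K))
  -- A majorant independent of `s` allows the sum and the time integral to be exchanged; each term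
  -- then integrates to an increment of `m j`.
  have key := intervalIntegral.hasSum_integral_of_dominated_convergence (μ := volume) (a := 0)
    (b := t)
    (F := fun j s => 2 * sineCoeff φ j *
      (-eigenvalue α (j + 1) * m j s - deriv (mode (j + 1)) 1 * U s))
    (f := fun s => pairing (u s) (fun x => deriv (deriv φ) x + α * φ x) - U s * deriv φ 1)
    (fun j _ => 2 * (|sineCoeff φ j * eigenvalue α (j + 1)| * |c j|) +
      2 * K * |sineCoeff φ j * deriv (mode (j + 1)) 1|)
    (fun j => by have := hmcont j; exact (by fun_prop : Continuous _).aestronglyMeasurable)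
    (fun j => ae_of_all _ fun s hs => by
      rw [uIoc_of_le ht] at hs
      have h1 := (hmc j s hs.1.le).trans (le_abs_self _)
      have h2 := hUK s hs.1.le
      have e : 2 * sineCoeff φ j * (-eigenvalue α (j + 1) * m j s - deriv (mode (j + 1)) 1 * U s) =
        -(2 * (sineCoeff φ j * eigenvalue α (j + 1) * m j s)) -
          2 * (sineCoeff φ j * deriv (mode (j + 1)) 1 * U s) := by ring
      rw [e, Real.norm_eq_abs]
      refine (abs_sub _ _).trans ?_
      rw [abs_neg, abs_mul, abs_mul, abs_mul 2, abs_mul _ (U s), abs_two]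
      calc _ ≤ 2 * (|sineCoeff φ j * eigenvalue α (j + 1)| * |c j|) +
            2 * (|sineCoeff φ j * deriv (mode (j + 1)) 1| * K) := by gcongr
        _ = _ := by ring)
    (ae_of_all _ fun _ _ => hsum) intervalIntegrable_const
    (ae_of_all _ fun s hs => by
      rw [uIoc_of_le ht] at hs
      exact hF s hs.1.le)
  have hdiff : HasSum (fun j => 2 * sineCoeff φ j * (m j t - m j 0))
      (pairing (u t) φ - pairing u₀ φ) := by
    have h1 := (hasSum_pairing hφ.continuous (u t)).sub (hasSum_pairing hφ.continuous u₀)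
    convert! h1 using 2 with j
    rw [hum t ht, ← h0, hum 0 self_mem_Ici]
    ring
  have hterm : ∀ j, ∫ s in (0 : ℝ)..t, 2 * sineCoeff φ j *
      (-eigenvalue α (j + 1) * m j s - deriv (mode (j + 1)) 1 * U s) =
      2 * sineCoeff φ j * (m j t - m j 0) := by
    intro j
    have := hmcont j
    rw [intervalIntegral.integral_const_mul, intervalIntegral.integral_eq_sub_of_hasDerivAt
      (fun s _ => hm j s) (Continuous.intervalIntegrable (by fun_prop) _ _)]
  simp only [hterm] at key
  rw [← hdiff.unique key]
  ring

/-! ### Existence and the main theorem -/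

lemma exists_closedLoopSolution (hα : 0 < α) (hρ : 0 < ρ)
    (hN : ∀ j : ℕ, 1 ≤ j → (eigenvalue α j < ρ ↔ j ≤ N)) (hργ : ∀ k, ρ < γ k)
    (hP : IsUnit (colMat α N γ)) (hne : ∀ (k i : Fin N), γ k ≠ eigenvalue α (i + 1)) (u₀ : L2) :
    ∃ u : ℝ → L2, IsClosedLoopSolution α N γ u₀ u := by
  obtain ⟨K, hK, hb⟩ := exists_modalFlow_bound hα hρ hN hργ hP hne
  obtain ⟨m, U, hflow, hU, hm0, hm⟩ := exists_modalFlow hP hne fun j => pairing u₀ (mode (j + 1))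
  have hbound := hb m U hflow ‖u₀‖ fun j => by rw [hm0]; exact abs_pairing_mode_le u₀ j
  have hexp : ∀ t : ℝ, 0 ≤ t → Real.exp (-(ρ / 2) * t) ≤ 1 := fun t ht =>
    Real.exp_le_one_iff.2 (by nlinarith)
  set c : ℕ → ℝ := fun j => |m j 0| + K * ‖u₀‖ / (j + 1) with hcdef
  have hc : Summable fun j => c j ^ 2 := by
    have h1 : Summable fun j => pairing u₀ (mode (j + 1)) ^ 2 := by
      simpa [summable_mul_left_iff] using (hasSum_sq_pairing u₀).summable
    refine ((h1.mul_left 2).add (summable_one_div_succ_sq.mul_left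
      (2 * (K * ‖u₀‖) ^ 2))).of_nonneg_of_le (fun _ => sq_nonneg _) fun j => ?_
    refine add_sq_le.trans (le_of_eq ?_)
    rw [sq_abs, hm0, div_pow]; ring
  have hmc : ∀ j, ∀ t ∈ Ici (0 : ℝ), |m j t| ≤ c j := fun j t ht =>
    ((hbound t ht).2 j).trans (mul_le_of_le_one_left (by positivity) (hexp t ht))
  have hUK : ∀ t, 0 ≤ t → |U t| ≤ K * ‖u₀‖ := fun t ht =>
    (hbound t ht).1.trans (mul_le_of_le_one_right (by positivity) (hexp t ht))
  obtain ⟨u, hu, hum⟩ := exists_continuousOn_of_coeff (s := Ici 0) m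
    (fun j => continuous_iff_continuousAt.2 fun t => (hm j t).continuousAt) c hc hmc
  have h0 : u 0 = u₀ := by
    rw [← sub_eq_zero]
    refine eq_zero_of_pairing_mode_eq_zero _ fun j => ?_
    rw [pairing_sub (continuous_mode _), hum 0 self_mem_Ici, hm0, sub_self]
  have hsol := isBoundarySolution_of_coeff hu h0 hU hm hum hc hmc hUK
  -- The curve was built for the prescribed input `U`; the loop closes because the low moments of `u
  -- t` are the coefficients from which `U` is computed.
  have hfeed : ∀ t, 0 ≤ t → feedback α N γ (u t) = U t := by
    intro t ht
    rw [feedback_eq hP, hflow.input t ht]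
    have : moments N (u t) = fun i : Fin N => m i t := by
      ext i; exact hum t ht i
    rw [this]
  refine ⟨u, hsol.continuousOn, hsol.initial, fun φ hφ h0 h1 t ht => ?_⟩
  rw [hsol.weak φ hφ h0 h1 t ht]
  congr 1
  refine intervalIntegral.integral_congr fun s hs => ?_
  rw [uIcc_of_le ht] at hs
  simp only [hfeed s hs.1]

end FisherBoundary

end


theorem theorem2p1 (α ρ : ℝ) (hα : 0 < α) (hρ : 0 < ρ) (N : ℕ)
    (hN : ∀ j : ℕ, 1 ≤ j → (FisherBoundary.eigenvalue α j < ρ ↔ j ≤ N))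
    (γ : Fin N → ℝ) (hγ : StrictMono γ) (hργ : ∀ k, ρ < γ k) :
    IsUnit (FisherBoundary.sumB α N γ) ∧
    (∀ u₀ : FisherBoundary.L2, ∃ u : ℝ → FisherBoundary.L2,
      FisherBoundary.IsClosedLoopSolution α N γ u₀ u ∧
      ∀ v : ℝ → FisherBoundary.L2, FisherBoundary.IsClosedLoopSolution α N γ u₀ v →
        Set.EqOn v u (Set.Ici 0)) ∧
    ∃ C : ℝ, 0 < C ∧ ∃ μ : ℝ, 0 < μ ∧
      ∀ (u₀ : FisherBoundary.L2) (u : ℝ → FisherBoundary.L2),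
        FisherBoundary.IsClosedLoopSolution α N γ u₀ u →
          ∀ t : ℝ, 0 ≤ t → ‖u t‖ ≤ C * Real.exp (-μ * t) * ‖u₀‖ := by
  have hne : ∀ k i : Fin N, γ k ≠ FisherBoundary.eigenvalue α (i + 1) := fun k i =>
    -- The first `N` eigenvalues lie below `ρ` and every `γ k` above it, so no denominator vanishes.
    (((hN (i + 1) (by omega)).2 i.isLt).trans (hργ k)).ne'
  have hP := FisherBoundary.isUnit_colMat hγ.injective hne
  obtain ⟨C, hC, hdecay⟩ := FisherBoundary.exists_decay hα hρ hN hργ hP hne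
  refine ⟨?_, fun u₀ => ?_, C, hC, ρ / 2, half_pos hρ, hdecay⟩
  · rw [FisherBoundary.sumB_eq]
    exact hP.mul ((Matrix.isUnit_transpose _).2 hP)
  · obtain ⟨u, hu⟩ := FisherBoundary.exists_closedLoopSolution hα hρ hN hργ hP hne u₀
    refine ⟨u, hu, fun v hv t ht => ?_⟩
    -- The difference of two solutions solves the closed loop with datum zero, so the decay estimate
    -- forces it to vanish.
    have h := hdecay _ _ (hv.sub hP hu) t ht
    rw [sub_self, norm_zero, mul_zero] at h
    exact sub_eq_zero.1 (norm_le_zero_iff.1 h)
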